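/- Let $\mathcal G$ be a second countable, locally compact Hausdorff, étale groupoid with range and source maps $r,s$, and let $c\colon\mathcal G^{(2)}\to\mathbb T$ be a continuous 2-cocycle, i.e. $c(x,yz)\,c(y,z)=c(x,y)\,c(xy,z)$ for composable $x,y,z$, which is normalized: $c(r(\gamma),\gamma)=1=c(\gamma,s(\gamma))$. Let $\mathcal S\subseteq\mathrm{Iso}(\mathcal G)=\{\gamma: r(\gamma)=s(\gamma)\}$ be a clopen, normal, Abelian subgroupoid containing $\mathcal G^{(0)}$ such that $c(a,b)=c(b,a)$ for all composable $a,b\in\mathcal S$. Let $\mathcal Q=\mathcal G/\mathcal S$ be the quotient groupoid with the quotient topology, and write $\dot\gamma=\gamma\mathcal S\in\mathcal Q$ for the class of $\gamma\in\mathcal G$; identify $\mathcal Q^{(0)}$ with $\mathcal G^{(0)}$. For $u\in\mathcal G^{(0)}$ let $\mathcal S_u=\{a\in\mathcal S: r(a)=u\}$ and let $\widehat{\mathcal S}_{c,u}$ be the set of all $\chi\colon\mathcal S_u\to\mathbb T$ with $\chi(a)\chi(b)=c(a,b)\chi(ab)$ for $a,b\in\mathcal S_u$. Let $\widehat{\mathcal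 S}_c=\bigsqcup_u\widehat{\mathcal S}_{c,u}$ and let $\rho\colon\widehat{\mathcal S}_c\to\mathcal Q^{(0)}$ be given by $\rho|_{\widehat{\mathcal S}_{c,u}}=u$. Give $\widehat{\mathcal S}_c$ the topology of pointwise convergence of the functionals $\phi_\chi\colon C_c(\mathcal S,c)\to\mathbb C$, $\phi_\chi(f)=\sum_{a\in\mathcal S_{\rho(\chi)}}\chi(a)f(a)$, i.e. the coarsest topology for which $\chi\mapsto\phi_\chi(f)$ is continuous for every $f\in C_c(\mathcal S,c)$ (this is the topology induced by $\chi\mapsto\phi_\chi$ from the weak-$*$ topology on the spectrum of $C^*_r(\mathcal S,c)$). Let $\mathcal Q\ast_\rho\widehat{\mathcal S}_c=\{(\dot\gamma,\chi): s(\dot\gamma)=\rho(\chi)\}$, with the subspace topology of the product. For $\gamma\in\mathcal G$, $\chi\in\widehat{\mathcal S}_{c,s(\gamma)}$ and $a\in\mathcal S_{r(\gamma)}$ put $$\tilde\alpha_{\dot\gamma}(\chi)(a)=\overline{c(\gamma,\gamma^{-1})}\;c(\gamma^{-1},a)\;c(\gamma^{-1}a,\gamma)\;\chi(\gamma^{-1}a\gamma).$$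 Then: 1. $\tilde\alpha_{\dot\gamma}(\chi)$ depends only on $\dot\gamma\in\mathcal Q$, not on the representative $\gamma$. 2. $\tilde\alpha_{\dot\gamma}(\chi)\in\widehat{\mathcal S}_{c,r(\gamma)}$, and $\tilde\alpha_{\dot\tau\dot\gamma}(\chi)=\tilde\alpha_{\dot\tau}(\tilde\alpha_{\dot\gamma}(\chi))$ whenever $s(\tau)=r(\gamma)$. 3. $\tilde\alpha_u(\chi)=\chi$ for every unit $u$ and every $\chi\in\widehat{\mathcal S}_{c,u}$. 4. The map $\mathcal Q\ast_\rho\widehat{\mathcal S}_c\to\widehat{\mathcal S}_c$, $(\dot\gamma,\chi)\mapsto\tilde\alpha_{\dot\gamma}(\chi)$, is continuous. In other words, $\rho$ is continuous and $\tilde\alpha$ is a continuous left action of $\mathcal Q$ on $\widehat{\mathcal S}_c$ with moment map $\rho$. -/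

import Mathlib

/-! ## Groupoids -/

section Basic

variable {G : Type*} [Mul G] [Inv G]

/-- The range map `r(γ) = γ γ⁻¹`. -/
def rng (x : G) : G := x * x⁻¹

/-- The source map `s(γ) = γ⁻¹ γ`. -/
def src (x : G) : G := x⁻¹ * x

end Basic

/-- An algebraic groupoid on a set of arrows `G`. The product `x * y` is only meaningful on
composable pairs, i.e. pairs with `src x = rng y`; its values elsewhere are unconstrained and never
used. -/
class Gpd (G : Type*) extends Mul G, Inv G where
  inv_inv' : ∀ x : G, x⁻¹⁻¹ = x
  rng_mul' : ∀ x y : G, src x = rng y → rng (x * y) = rng x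
  src_mul' : ∀ x y : G, src x = rng y → src (x * y) = src y
  mul_assoc' : ∀ x y z : G, src x = rng y → src y = rng z → x * y * z = x * (y * z)
  rng_mul_self' : ∀ x : G, rng x * x = x
  self_mul_src' : ∀ x : G, x * src x = x

/-- The unit space `{γ γ⁻¹}`. -/
def unitSpace (G : Type*) [Gpd G] : Set G := Set.range (rng : G → G)

namespace Gpd

variable {G : Type*} [Gpd G]

theorem src_inv (x : G) : src x⁻¹ = rng x := by simp only [src, rng, inv_inv']

theorem rng_inv (x : G) : rng x⁻¹ = src x := by simp only [src, rng, inv_inv']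

theorem rng_src (x : G) : rng (src x) = src x := by
  rw [show src x = x⁻¹ * x from rfl, rng_mul' _ _ (src_inv x), rng_inv]; rfl

theorem src_src (x : G) : src (src x) = src x := by
  rw [show src x = x⁻¹ * x from rfl, src_mul' _ _ (src_inv x)]; rfl

theorem rng_rng (x : G) : rng (rng x) = rng x := by
  have h := rng_src x⁻¹
  rwa [src_inv] at h

theorem src_rng (x : G) : src (rng x) = rng x := by
  have h := src_src x⁻¹
  rwa [src_inv] at h

theorem mul_mul_inv (x y : G) (h : src x = rng y) : x * y * y⁻¹ = x := by
  rw [mul_assoc' _ _ _ h (rng_inv y).symm, show y * y⁻¹ = rng y from rfl, ← h, self_mul_src']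

theorem inv_mul_mul (x y : G) (h : src x = rng y) : x⁻¹ * (x * y) = y := by
  rw [← mul_assoc' _ _ _ (src_inv x) h, show x⁻¹ * x = src x from rfl, h, rng_mul_self']

theorem mul_inv_mul (x y : G) (h : rng x = rng y) : x * (x⁻¹ * y) = y := by
  rw [← mul_assoc' _ _ _ (rng_inv x).symm ((src_inv x).trans h),
    show x * x⁻¹ = rng x from rfl, h, rng_mul_self']

theorem mul_inv_rev' (x y : G) (h : src x = rng y) : (x * y)⁻¹ = y⁻¹ * x⁻¹ := by
  have h1 : src y⁻¹ = rng x⁻¹ := by rw [src_inv, rng_inv, h]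
  have h2 : src (x * y) = rng (y⁻¹ * x⁻¹) := by rw [src_mul' _ _ h, rng_mul' _ _ h1, rng_inv]
  have h3 : (x * y) * (y⁻¹ * x⁻¹) = rng (x * y) := by
    rw [← mul_assoc' _ _ _ ((src_mul' _ _ h).trans (rng_inv y).symm) h1, mul_mul_inv _ _ h,
      rng_mul' _ _ h]; rfl
  have h4 := inv_mul_mul (x * y) (y⁻¹ * x⁻¹) h2
  rw [h3, ← src_inv, self_mul_src'] at h4
  exact h4

theorem src_of_mem {u : G} (hu : u ∈ unitSpace G) : src u = u := by
  obtain ⟨x, rfl⟩ := hu; exact src_rng x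

theorem rng_of_mem {u : G} (hu : u ∈ unitSpace G) : rng u = u := by
  obtain ⟨x, rfl⟩ := hu; exact rng_rng x

theorem rng_mem (x : G) : rng x ∈ unitSpace G := ⟨x, rfl⟩

theorem src_mem (x : G) : src x ∈ unitSpace G := ⟨x⁻¹, rng_inv x⟩

/-- The range map as a map onto the unit space. -/
def rngU (x : G) : unitSpace G := ⟨rng x, rng_mem x⟩

/-- The source map as a map onto the unit space. -/
def srcU (x : G) : unitSpace G := ⟨src x, src_mem x⟩

/-- The set of composable pairs. -/
def composable (G : Type*) [Gpd G] : Set (G × G) := {p | src p.1 = rng p.2}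

end Gpd

/-- Multiplication (on composable pairs) and inversion are continuous. -/
structure IsTopologicalGpd (G : Type*) [Gpd G] [TopologicalSpace G] : Prop where
  continuousOn_mul : ContinuousOn (fun p : G × G => p.1 * p.2) (Gpd.composable G)
  continuous_inv : Continuous (fun x : G => x⁻¹)

/-- A topological groupoid whose range and source maps onto the unit space (with the subspace
topology) are local homeomorphisms. -/
structure IsEtaleGpd (G : Type*) [Gpd G] [TopologicalSpace G] : Prop extends
    IsTopologicalGpd G where
  rng_localHomeo : IsLocalHomeomorph (Gpd.rngU : G → unitSpace G)
  src_localHomeo : IsLocalHomeomorph (Gpd.srcU : G → unitSpace G)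

/-- A normalized continuous circle-valued 2-cocycle; only the values of `c` on composable pairs
matter. -/
structure IsCocycle {G : Type*} [Gpd G] [TopologicalSpace G] (c : G → G → Circle) : Prop where
  cocycle : ∀ x y z : G, src x = rng y → src y = rng z →
    c x (y * z) * c y z = c x y * c (x * y) z
  rng_left : ∀ x : G, c (rng x) x = 1
  src_right : ∀ x : G, c x (src x) = 1
  continuousOn : ContinuousOn (fun p : G × G => c p.1 p.2) (Gpd.composable G)

/-- A normal subgroupoid of `G` that contains all units and is contained in the isotropy
`{γ | r(γ) = s(γ)}`. -/
structure NormalIsoSubgpd (G : Type*) [Gpd G] where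
  carrier : Set G
  mul_mem : ∀ a b : G, a ∈ carrier → b ∈ carrier → src a = rng b → a * b ∈ carrier
  inv_mem : ∀ a : G, a ∈ carrier → a⁻¹ ∈ carrier
  unit_mem : ∀ u : G, u ∈ unitSpace G → u ∈ carrier
  isotropy : ∀ a : G, a ∈ carrier → rng a = src a
  conj_mem : ∀ g a : G, a ∈ carrier → src g = rng a → g * a * g⁻¹ ∈ carrier

namespace NormalIsoSubgpd

open Gpd

variable {G : Type*} [Gpd G] (S : NormalIsoSubgpd G)

/-! ## The quotient groupoid -/

theorem conj_mem' {g a : G} (ha : a ∈ S.carrier) (h : rng g = rng a) :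
    g⁻¹ * a * g ∈ S.carrier := by
  have := S.conj_mem g⁻¹ a ha ((src_inv g).trans h)
  rwa [inv_inv'] at this

/-- `γ ∼ η` iff `η ∈ γ S`. -/
def setoid : Setoid G where
  r x y := ∃ a ∈ S.carrier, src x = rng a ∧ y = x * a
  iseqv := by
    refine ⟨fun x => ⟨src x, S.unit_mem _ (src_mem x), (rng_src x).symm,
      (self_mul_src' x).symm⟩, ?_, ?_⟩
    · rintro x y ⟨a, ha, h, rfl⟩
      refine ⟨a⁻¹, S.inv_mem a ha, ?_, (mul_mul_inv _ _ h).symm⟩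
      rw [src_mul' _ _ h, rng_inv]
    · rintro x y z ⟨a, ha, h, rfl⟩ ⟨b, hb, h', rfl⟩
      rw [src_mul' _ _ h] at h'
      exact ⟨a * b, S.mul_mem a b ha hb h', by rw [rng_mul' _ _ h', h],
        mul_assoc' _ _ _ h h'⟩

theorem rng_eq_of_rel {x y : G} (h : S.setoid x y) : rng x = rng y := by
  obtain ⟨a, _, h, rfl⟩ := h
  rw [rng_mul' _ _ h]

theorem src_eq_of_rel {x y : G} (h : S.setoid x y) : src x = src y := by
  obtain ⟨a, ha, h, rfl⟩ := h
  rw [src_mul' _ _ h, h, S.isotropy a ha]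

/-- The quotient `G / S`, whose elements are the cosets `γ S`. -/
def Quo : Type _ := Quotient S.setoid

/-- The quotient map `γ ↦ γ S`. -/
def q (x : G) : S.Quo := Quotient.mk S.setoid x

/-- The quotient topology. -/
instance [TopologicalSpace G] : TopologicalSpace S.Quo :=
  inferInstanceAs (TopologicalSpace (Quotient S.setoid))

theorem q_eq_iff {x y : G} : S.q x = S.q y ↔ S.setoid x y :=
  Quotient.eq

theorem mul_rel {x x' y y' : G} (hx : S.setoid x x') (hy : S.setoid y y') (h : src x = rng y) :
    S.setoid (x * y) (x' * y') := by
  obtain ⟨a, ha, hxa, rfl⟩ := hx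
  obtain ⟨b, hb, hyb, rfl⟩ := hy
  have hay : src a = rng y := by rw [← S.isotropy a ha, ← hxa, h]
  have hya : rng y = rng a := by rw [← hxa, h]
  have h1 : src (y⁻¹ * a) = rng y := by rw [src_mul' _ _ ((src_inv y).trans hya), hay]
  have h2 : rng (y⁻¹ * a * y) = src y := by
    rw [rng_mul' _ _ h1, rng_mul' _ _ ((src_inv y).trans hya), rng_inv]
  have h3 : src (y⁻¹ * a * y) = rng b := by rw [src_mul' _ _ h1, hyb]
  refine ⟨y⁻¹ * a * y * b, S.mul_mem _ _ (S.conj_mem' ha hya) hb h3, ?_, ?_⟩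
  · rw [src_mul' _ _ h, rng_mul' _ _ h3, h2]
  · have h4 : y * (y⁻¹ * a * y) = a * y := by
      rw [mul_assoc' _ _ _ ((src_inv y).trans hya) hay]
      exact mul_inv_mul _ _ (by rw [rng_mul' _ _ hay, hya])
    have h5 : src (a * y) = rng b := by rw [src_mul' _ _ hay, hyb]
    have h6 : src x = rng (a * y) := by rw [rng_mul' _ _ hay, hxa]
    rw [← mul_assoc' (x * y) _ b (by rw [src_mul' _ _ h, h2]) h3,
      mul_assoc' x y _ h h2.symm, h4, mul_assoc' x (a * y) b h6 h5,
      mul_assoc' a y b hay hyb, ← mul_assoc' x a (y * b) hxa (by rw [rng_mul' _ _ hyb, hay])]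

theorem inv_rel {x x' : G} (hx : S.setoid x x') : S.setoid x⁻¹ x'⁻¹ := by
  obtain ⟨a, ha, hxa, rfl⟩ := hx
  have hs : src a⁻¹ = rng a⁻¹ := (S.isotropy _ (S.inv_mem a ha)).symm
  have h1 : src x = rng a⁻¹ := by rw [hxa, ← hs, src_inv]
  have h2 : src a⁻¹ = rng x⁻¹ := by rw [src_inv, rng_inv, hxa]
  have h3 : src (x * a⁻¹) = rng x⁻¹ := by rw [src_mul' _ _ h1, h2]
  refine ⟨x * a⁻¹ * x⁻¹, S.conj_mem x _ (S.inv_mem a ha) h1, ?_, ?_⟩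
  · rw [rng_mul' _ _ h3, rng_mul' _ _ h1, src_inv]
  · rw [mul_inv_rev' _ _ hxa, mul_assoc' x _ _ h1 h2]
    exact (inv_mul_mul x (a⁻¹ * x⁻¹) (by rw [rng_mul' _ _ h2, h1])).symm

open Classical in
/-- `[x][y] = [x y]` for composable `x`, `y` (with an irrelevant value otherwise). -/
noncomputable instance : Mul S.Quo where
  mul := Quotient.lift₂ (fun x y => if src x = rng y then S.q (x * y) else S.q x) (by
    intro x y x' y' hx hy
    rw [← S.src_eq_of_rel hx, ← S.rng_eq_of_rel hy]
    split_ifs with h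
    · exact S.q_eq_iff.2 (S.mul_rel hx hy h)
    · exact S.q_eq_iff.2 hx)

/-- `[x]⁻¹ = [x⁻¹]`. -/
instance : Inv S.Quo where
  inv := Quotient.lift (fun x => S.q x⁻¹) (fun _ _ h => S.q_eq_iff.2 (S.inv_rel h))

theorem q_mul {x y : G} (h : src x = rng y) : S.q x * S.q y = S.q (x * y) :=
  if_pos h

theorem q_inv (x : G) : (S.q x)⁻¹ = S.q x⁻¹ := rfl

theorem rng_q (x : G) : rng (S.q x) = S.q (rng x) := by
  rw [rng, q_inv, S.q_mul (rng_inv x).symm]; rfl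

theorem src_q (x : G) : src (S.q x) = S.q (src x) := by
  rw [src, q_inv, S.q_mul (src_inv x)]; rfl

theorem q_inj_unit {u v : G} (hu : u ∈ unitSpace G) (hv : v ∈ unitSpace G) :
    S.q u = S.q v ↔ u = v := by
  refine ⟨fun h => ?_, fun h => by rw [h]⟩
  have := S.rng_eq_of_rel (S.q_eq_iff.1 h)
  rwa [rng_of_mem hu, rng_of_mem hv] at this

theorem comp_q_iff (x y : G) : src (S.q x) = rng (S.q y) ↔ src x = rng y := by
  rw [src_q, rng_q, S.q_inj_unit (src_mem x) (rng_mem y)]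

/-- The quotient groupoid `G / S`. -/
noncomputable instance : Gpd S.Quo where
  inv_inv' := by
    rintro ⟨x⟩
    exact congrArg S.q (inv_inv' x)
  rng_mul' := by
    rintro ⟨x⟩ ⟨y⟩ h
    change rng (S.q x * S.q y) = rng (S.q x)
    have h : src x = rng y := (S.comp_q_iff x y).1 h
    rw [S.q_mul h, rng_q, rng_q, rng_mul' _ _ h]
  src_mul' := by
    rintro ⟨x⟩ ⟨y⟩ h
    change src (S.q x * S.q y) = src (S.q y)
    have h : src x = rng y := (S.comp_q_iff x y).1 h
    rw [S.q_mul h, src_q, src_q, src_mul' _ _ h]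
  mul_assoc' := by
    rintro ⟨x⟩ ⟨y⟩ ⟨z⟩ h h'
    change S.q x * S.q y * S.q z = S.q x * (S.q y * S.q z)
    have h : src x = rng y := (S.comp_q_iff x y).1 h
    have h' : src y = rng z := (S.comp_q_iff y z).1 h'
    rw [S.q_mul h, S.q_mul h', S.q_mul (by rw [src_mul' _ _ h, h']),
      S.q_mul (by rw [rng_mul' _ _ h', h]), mul_assoc' _ _ _ h h']
  rng_mul_self' := by
    rintro ⟨x⟩
    change rng (S.q x) * S.q x = S.q x
    rw [rng_q, S.q_mul (src_rng x), rng_mul_self']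
  self_mul_src' := by
    rintro ⟨x⟩
    change S.q x * src (S.q x) = S.q x
    rw [src_q, S.q_mul (rng_src x).symm, self_mul_src']

/-! ## The twisted dual of the bundle `S` -/

/-- The fibre `S_u`. -/
def fiber (u : G) : Set G := {a | a ∈ S.carrier ∧ rng a = u}

theorem mul_mem_fiber {u : G} (a b : S.fiber u) : (a * b : G) ∈ S.fiber u := by
  have h : src (a : G) = rng (b : G) := by rw [← S.isotropy _ a.2.1, a.2.2, b.2.2]
  exact ⟨S.mul_mem _ _ a.2.1 b.2.1 h, by rw [rng_mul' _ _ h, a.2.2]⟩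

/-- `χ : S_u → 𝕋` is a one-dimensional `c`-projective representation:
`χ(a) χ(b) = c(a, b) χ(a b)`. -/
def IsProjRep (c : G → G → Circle) {u : G} (χ : S.fiber u → Circle) : Prop :=
  ∀ a b : S.fiber u, χ a * χ b = c a b * χ ⟨a * b, S.mul_mem_fiber a b⟩

/-- The set `Ŝ_c`, the disjoint union over the units `u` of the sets of one-dimensional
`c`-projective representations of `S_u`. -/
structure Dual (c : G → G → Circle) where
  unit : unitSpace G
  rep : S.fiber (unit : G) → Circle
  isProjRep : S.IsProjRep c rep

open scoped CompactlySupported in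
/-- The functional `φ_χ(f) = ∑_{a ∈ S_u} χ(a) f(a)` on `C_c(S, c)`, where `χ` lies over `u`
(a finite sum when `G` is étale and Hausdorff). -/
noncomputable def Dual.phi [TopologicalSpace G] {S : NormalIsoSubgpd G} {c : G → G → Circle}
    (χ : S.Dual c) (f : C_c(S.carrier, ℂ)) : ℂ :=
  ∑ᶠ a : S.fiber (χ.unit : G), (χ.rep a : ℂ) * f ⟨a, a.2.1⟩

open scoped CompactlySupported in
/-- The topology on `Ŝ_c` induced by `χ ↦ φ_χ` from the weak-* topology on the spectrum of
`C*_r(S, c)`. As the characters `φ_χ` are contractive and `C_c(S, c)` is dense in `C*_r(S, c)`,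
this is the topology of pointwise convergence of `φ_χ` on `C_c(S, c)`: the coarsest topology making
every `χ ↦ φ_χ(f)` with `f ∈ C_c(S, c)` continuous. -/
noncomputable instance [TopologicalSpace G] (c : G → G → Circle) :
    TopologicalSpace (S.Dual c) :=
  ⨅ f : C_c(S.carrier, ℂ), TopologicalSpace.induced (fun χ => χ.phi f) inferInstance

/-- The moment map `ρ : Ŝ_c → (G / S)⁽⁰⁾` with value `u` (that is, `[u]`) on representations
of `S_u`. -/
def moment (c : G → G → Circle) (χ : S.Dual c) : unitSpace S.Quo :=
  ⟨S.q χ.unit, S.q χ.unit, by rw [rng_q, rng_of_mem χ.unit.2]⟩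

theorem src_q_eq_moment {c : G → G → Circle} {γ : G} {χ : S.Dual c} (h : src γ = χ.unit) :
    src (S.q γ) = S.moment c χ := by
  rw [src_q, h]; rfl

theorem conj_mem_fiber {γ u : G} (h : src γ = u) (a : S.fiber (rng γ)) :
    γ⁻¹ * (a : G) * γ ∈ S.fiber u := by
  have ha : rng γ = rng (a : G) := a.2.2.symm
  refine ⟨S.conj_mem' a.2.1 ha, ?_⟩
  have h0 : src γ⁻¹ = rng (a : G) := (src_inv γ).trans ha
  have h1 : src (γ⁻¹ * (a : G)) = rng γ := by
    exact (src_mul' _ _ h0).trans ((S.isotropy _ a.2.1).symm.trans ha.symm)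
  rw [rng_mul' _ _ h1, rng_mul' _ _ h0, rng_inv, h]

/-- For `γ` with `s(γ) = u` and `χ` on `S_u`, the function on `S_{r(γ)}` given by
`a ↦ conj(c(γ, γ⁻¹)) c(γ⁻¹, a) c(γ⁻¹ a, γ) χ(γ⁻¹ a γ)`
(the inverse in the circle group is complex conjugation). -/
noncomputable def tildeAlpha (c : G → G → Circle) (γ : G) {u : G} (h : src γ = u) (χ : S.fiber u → Circle)
    (a : S.fiber (rng γ)) : Circle :=
  (c γ γ⁻¹)⁻¹ * c γ⁻¹ a * c (γ⁻¹ * a) γ * χ ⟨γ⁻¹ * a * γ, S.conj_mem_fiber h a⟩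

end NormalIsoSubgpd

/-! ## Groupoid actions -/

/-- The fibred product `Q ∗_ρ X = {(g, x) | s(g) = ρ(x)}`, with the subspace topology of the
product when `Q` and `X` carry topologies. -/
abbrev FibProd {Q X : Type*} [Gpd Q] (ρ : X → unitSpace Q) : Type _ :=
  {p : Q × X // src p.1 = (ρ p.2 : Q)}

/-- `act` is a continuous left action of `Q` on `X` with moment map `ρ`. -/
structure IsContinuousLeftAction {Q X : Type*} [Gpd Q] [TopologicalSpace Q] [TopologicalSpace X]
    (ρ : X → unitSpace Q) (act : FibProd ρ → X) : Prop where
  continuous_moment : Continuous ρ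
  moment_act : ∀ p : FibProd ρ, (ρ (act p) : Q) = rng p.1.1
  mul_act : ∀ (g h : Q) (x : X) (hgh : src g = rng h) (hx : src h = (ρ x : Q)),
    act ⟨(g * h, x), (Gpd.src_mul' g h hgh).trans hx⟩ =
      act ⟨(g, act ⟨(h, x), hx⟩), hgh.trans (moment_act ⟨(h, x), hx⟩).symm⟩
  unit_act : ∀ x : X, act ⟨((ρ x : Q), x), Gpd.src_of_mem (ρ x).2⟩ = x
  continuous_act : Continuous act

/-!
The algebraic part is read off from the extension `Twist hc` of `G` by the circle with product
`(z, x) (w, y) = (z w c(x, y), x y)`. A `c`-projective representation `χ` of `S_u` is the same thing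
as the homomorphism `X(z, a) = z χ(a)` on the part of the extension over `S_u` (`twistEval`), and
`tildeAlpha` is `a ↦ X(e⁻¹ (1, a) e)` for any lift `e` of `γ` (`twistEval_conj`). Multiplicativity in
`a` and the composition law are therefore the corresponding facts about conjugation. Arrows of `S`
act trivially since `X` has values in a commutative group (`tildeAlpha_of_mem`), so `tildeAlpha`
depends only on the coset and units act as the identity. This does not use the commutativity of
`S` or the symmetry of `c` on it, which serve to make the fibres of the twisted dual nonempty.

For continuity, the quotient map `G → G / S` is open (`isOpenMap_q`), so it suffices to work with
`(γ, χ)` in `G ∗ Ŝ_c`. Let `σ` be a local section of the source map through `γ₀`. Substituting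
`a = γ b γ⁻¹` in the sum `φ_{γ·χ}(f)` and using `γ = σ(s(γ))` near `γ₀` gives `φ_χ(g)` with a
`g ∈ C_c(S, c)` that does not depend on `(γ, χ)` near the given point
(`Dual.exists_phi_translate_eq`). Continuity of `χ ↦ φ_χ(g)` is the definition of the topology.
Continuity of the moment map follows by testing with functions supported on the unit space, which
is open.
-/

open Gpd Topology

/-! ### The central extension defined by a cocycle -/

section Twist

variable {G : Type*} [Gpd G] [TopologicalSpace G] {c : G → G → Circle}

theorem IsCocycle.inv_comm (hc : IsCocycle c) (x : G) : c x⁻¹ x = c x x⁻¹ := by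
  have h := hc.cocycle x x⁻¹ x (rng_inv x).symm (src_inv x)
  rw [show x⁻¹ * x = src x from rfl, show x * x⁻¹ = rng x from rfl, hc.src_right,
    hc.rng_left, one_mul, mul_one] at h
  exact h

/-- The extension of `G` by the circle with product `(z, x) (w, y) = (z w c(x, y), x y)`. -/
@[ext]
structure Twist (hc : IsCocycle c) where
  phase : Circle
  arrow : G

namespace Twist

variable {hc : IsCocycle c}

noncomputable instance : Mul (Twist hc) := ⟨fun e f => ⟨e.phase * f.phase * c e.arrow f.arrow, e.arrow * f.arrow⟩⟩

noncomputable instance : Inv (Twist hc) := ⟨fun e => ⟨e.phase⁻¹ * (c e.arrow e.arrow⁻¹)⁻¹, e.arrow⁻¹⟩⟩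

theorem phase_mul (e f : Twist hc) : (e * f).phase = e.phase * f.phase * c e.arrow f.arrow := rfl

theorem arrow_mul (e f : Twist hc) : (e * f).arrow = e.arrow * f.arrow := rfl

theorem phase_inv (e : Twist hc) : (e⁻¹).phase = e.phase⁻¹ * (c e.arrow e.arrow⁻¹)⁻¹ := rfl

theorem arrow_inv (e : Twist hc) : (e⁻¹).arrow = e.arrow⁻¹ := rfl

theorem rng_eq (e : Twist hc) : rng e = ⟨1, rng e.arrow⟩ := by
  ext1
  · rw [rng, phase_mul, phase_inv, arrow_inv, mul_inv_cancel_left, inv_mul_cancel]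
  · rfl

theorem src_eq (e : Twist hc) : src e = ⟨1, src e.arrow⟩ := by
  ext1
  · rw [src, phase_mul, phase_inv, arrow_inv, hc.inv_comm, mul_right_comm, inv_mul_cancel_right,
      inv_mul_cancel]
  · rfl

theorem src_eq_rng_iff {e f : Twist hc} : src e = rng f ↔ src e.arrow = rng f.arrow := by
  rw [src_eq, rng_eq, Twist.mk.injEq]
  simp only [true_and]

noncomputable instance : Gpd (Twist hc) where
  inv_inv' e := by
    ext1
    · rw [phase_inv, phase_inv, arrow_inv, inv_inv', hc.inv_comm, mul_inv, inv_inv, inv_inv,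
        mul_inv_cancel_right]
    · exact inv_inv' e.arrow
  rng_mul' e f h := by
    rw [rng_eq, rng_eq, arrow_mul, rng_mul' _ _ (src_eq_rng_iff.1 h)]
  src_mul' e f h := by
    rw [src_eq, src_eq, arrow_mul, src_mul' _ _ (src_eq_rng_iff.1 h)]
  mul_assoc' e f g h h' := by
    rw [src_eq_rng_iff] at h h'
    ext1
    · have := hc.cocycle _ _ _ h h'
      simp only [phase_mul, arrow_mul]
      calc e.phase * f.phase * c e.arrow f.arrow * g.phase * c (e.arrow * f.arrow) g.arrow
          = e.phase * f.phase * g.phase *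
            (c e.arrow f.arrow * c (e.arrow * f.arrow) g.arrow) := by ac_rfl
        _ = e.phase * (f.phase * g.phase * c f.arrow g.arrow) *
            c e.arrow (f.arrow * g.arrow) := by rw [← this]; ac_rfl
    · exact mul_assoc' _ _ _ h h'
  rng_mul_self' e := by
    rw [rng_eq]
    ext1
    · rw [phase_mul, hc.rng_left, one_mul, mul_one]
    · exact rng_mul_self' e.arrow
  self_mul_src' e := by
    rw [src_eq]
    ext1
    · rw [phase_mul, hc.src_right, mul_one, mul_one]
    · exact self_mul_src' e.arrow

end Twist

end Twist

/-! ### Conjugation in a groupoid -/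

namespace Gpd

variable {G : Type*} [Gpd G]

theorem conj_conj {x y a : G} (h : src x = rng y) (ha : rng x = rng a) (ha' : rng x = src a) :
    (x * y)⁻¹ * a * (x * y) = y⁻¹ * (x⁻¹ * a * x) * y := by
  have h1 : src y⁻¹ = rng x⁻¹ := by rw [src_inv, rng_inv, h]
  have h2 : src x⁻¹ = rng a := by rw [src_inv, ha]
  have h3 : src (x⁻¹ * a) = rng x := by rw [src_mul' _ _ h2, ha']
  have h4 : src y⁻¹ = rng (x⁻¹ * a) := by rw [rng_mul' _ _ h2, h1]
  have h5 : src (y⁻¹ * (x⁻¹ * a)) = rng x := by rw [src_mul' _ _ h4, h3]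
  rw [mul_inv_rev' _ _ h, mul_assoc' _ _ _ h1 h2, ← mul_assoc' _ _ _ h5 h,
    mul_assoc' _ _ _ h4 h3]

theorem conj_mul {x a b : G} (ha : rng x = rng a) (ha' : rng x = src a) (hb : rng x = rng b)
    (hb' : rng x = src b) : x⁻¹ * (a * b) * x = x⁻¹ * a * x * (x⁻¹ * b * x) := by
  have h1 : src x⁻¹ = rng a := by rw [src_inv, ha]
  have h2 : src x⁻¹ = rng b := by rw [src_inv, hb]
  have h3 : src a = rng b := by rw [← ha', hb]
  have h4 : src (x⁻¹ * a) = rng x := by rw [src_mul' _ _ h1, ha']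
  have h5 : src (x⁻¹ * b) = rng x := by rw [src_mul' _ _ h2, hb']
  have h6 : src x = rng (x⁻¹ * b) := by rw [rng_mul' _ _ h2, rng_inv]
  have h7 : src (x⁻¹ * a * x) = rng (x⁻¹ * b) := by rw [src_mul' _ _ h4, h6]
  rw [← mul_assoc' _ _ _ h7 h5, mul_assoc' _ _ _ h4 h6, mul_inv_mul _ _ hb,
    mul_assoc' _ _ _ h1 h3]

/-- Conjugation by `x` undoes conjugation by `x⁻¹`. -/
theorem conj_conj_inv {x b : G} (hb : src x = rng b) (hb' : src x = src b) :
    x⁻¹ * (x * b * x⁻¹) * x = b := by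
  have h1 : src (x * b) = rng x⁻¹ := by rw [src_mul' _ _ hb, ← hb', rng_inv]
  have h2 : src b = rng x⁻¹ := by rw [← hb', rng_inv]
  have h3 : src x = rng (b * x⁻¹) := by rw [rng_mul' _ _ h2, hb]
  rw [mul_assoc' _ _ _ hb h2, inv_mul_mul _ _ h3]
  have := mul_mul_inv b x⁻¹ h2
  rwa [inv_inv'] at this

end Gpd

/-! ### The algebra of the action -/

namespace NormalIsoSubgpd

variable {G : Type*} [Gpd G] {S : NormalIsoSubgpd G} {c : G → G → Circle}

theorem src_of_mem_fiber {u a : G} (ha : a ∈ S.fiber u) : src a = u :=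
  (S.isotropy a ha.1).symm.trans ha.2

theorem Dual.ext' {χ ψ : S.Dual c} (h : (χ.unit : G) = ψ.unit)
    (h' : ∀ (a : G) (ha : a ∈ S.fiber (χ.unit : G)) (ha' : a ∈ S.fiber (ψ.unit : G)),
      χ.rep ⟨a, ha⟩ = ψ.rep ⟨a, ha'⟩) : χ = ψ := by
  obtain ⟨u, χ, hχ⟩ := χ
  obtain ⟨v, ψ, hψ⟩ := ψ
  obtain rfl : u = v := Subtype.ext h
  obtain rfl : χ = ψ := funext fun a => h' a.1 a.2 a.2
  rfl

theorem src_eq_unit_of_q {x : S.Quo} {γ : G} {χ : S.Dual c} (hγ : S.q γ = x)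
    (h : src x = S.moment c χ) : src γ = χ.unit := by
  subst hγ
  rw [src_q] at h
  exact (S.q_inj_unit (src_mem γ) χ.unit.2).1 h

theorem conj_inv_conj {γ a : G} (ha : a ∈ S.fiber (rng γ)) : γ * (γ⁻¹ * a * γ) * γ⁻¹ = a := by
  have h1 : src γ⁻¹ = rng a := by rw [src_inv, ha.2]
  have h2 : src γ⁻¹ = src a := by rw [src_inv, src_of_mem_fiber ha]
  have := conj_conj_inv h1 h2
  rwa [inv_inv'] at this

theorem conj_mem_fiber_rng {γ b : G} (hb : b ∈ S.fiber (src γ)) :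
    γ * b * γ⁻¹ ∈ S.fiber (rng γ) := by
  have h1 : src γ = rng b := hb.2.symm
  refine ⟨S.conj_mem γ b hb.1 h1, ?_⟩
  rw [rng_mul' _ _ (by rw [src_mul' _ _ h1, src_of_mem_fiber hb, rng_inv]), rng_mul' _ _ h1]

variable [TopologicalSpace G] {hc : IsCocycle c} {u : G}

/-- The function `(z, a) ↦ z χ(a)` on the twist over `S_u`. It is multiplicative exactly when `χ`
is a `c`-projective representation. -/
noncomputable def twistEval (χ : S.fiber u → Circle) (e : Twist hc) (he : e.arrow ∈ S.fiber u) : Circle :=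
  e.phase * χ ⟨e.arrow, he⟩

theorem twistEval_congr (χ : S.fiber u → Circle) {e f : Twist hc} (h : e = f)
    (he : e.arrow ∈ S.fiber u) (hf : f.arrow ∈ S.fiber u) :
    twistEval χ e he = twistEval χ f hf := by
  subst h; rfl

theorem IsProjRep.twistEval_mul {χ : S.fiber u → Circle} (hχ : S.IsProjRep c χ) {e f : Twist hc}
    (he : e.arrow ∈ S.fiber u) (hf : f.arrow ∈ S.fiber u) (hef : (e * f).arrow ∈ S.fiber u) :
    twistEval χ (e * f) hef = twistEval χ e he * twistEval χ f hf := by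
  have h := hχ ⟨_, he⟩ ⟨_, hf⟩
  calc twistEval χ (e * f) hef
      = e.phase * f.phase * (c e.arrow f.arrow * χ ⟨e.arrow * f.arrow, hef⟩) :=
        mul_assoc _ _ _
    _ = e.phase * f.phase * (χ ⟨_, he⟩ * χ ⟨_, hf⟩) := by rw [h]
    _ = _ := mul_mul_mul_comm _ _ _ _

/-- `tildeAlpha` is evaluation on conjugates in the twist. The conjugating element may be any lift
of `γ`, since the circle is central. -/
theorem twistEval_conj (χ : S.fiber u → Circle) (e a : Twist hc) (h : src e.arrow = u)
    (ha : a.arrow ∈ S.fiber (rng e.arrow)) (ha' : (e⁻¹ * a * e).arrow ∈ S.fiber u) :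
    twistEval χ (e⁻¹ * a * e) ha' = twistEval (S.tildeAlpha c e.arrow h χ) a ha := by
  have h1 : (e⁻¹ * a * e).phase = a.phase * ((c e.arrow e.arrow⁻¹)⁻¹ * c e.arrow⁻¹ a.arrow *
      c (e.arrow⁻¹ * a.arrow) e.arrow) := by
    simp only [Twist.phase_mul, Twist.phase_inv, Twist.arrow_mul, Twist.arrow_inv]
    calc _ = e.phase⁻¹ * e.phase * (a.phase * ((c e.arrow e.arrow⁻¹)⁻¹ * c e.arrow⁻¹ a.arrow *
      c (e.arrow⁻¹ * a.arrow) e.arrow)) := by ac_rfl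
      _ = _ := by rw [inv_mul_cancel, one_mul]
  rw [twistEval, h1, mul_assoc]
  rfl

theorem tildeAlpha_eq_twistEval (hc : IsCocycle c) (χ : S.fiber u → Circle) (e : Twist hc) {γ : G}
    (hγ : e.arrow = γ) (h : src γ = u) (a : S.fiber (rng γ))
    (ha' : (e⁻¹ * ⟨1, a⟩ * e).arrow ∈ S.fiber u) :
    S.tildeAlpha c γ h χ a = twistEval χ (e⁻¹ * ⟨1, a⟩ * e) ha' := by
  subst hγ
  rw [twistEval_conj χ e ⟨1, a⟩ h a.2 ha']
  exact (one_mul _).symm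

theorem isProjRep_tildeAlpha (hc : IsCocycle c) {χ : S.fiber u → Circle} (hχ : S.IsProjRep c χ)
    {γ : G} (h : src γ = u) : S.IsProjRep c (S.tildeAlpha c γ h χ) := by
  intro a b
  let e : Twist hc := ⟨1, γ⟩
  have hab := S.conj_mem_fiber h ⟨_, S.mul_mem_fiber a b⟩
  have h1 := tildeAlpha_eq_twistEval hc χ e rfl h a (S.conj_mem_fiber h a)
  have h2 := tildeAlpha_eq_twistEval hc χ e rfl h b (S.conj_mem_fiber h b)
  have h3 := twistEval_conj χ e (⟨1, a⟩ * ⟨1, b⟩) h (S.mul_mem_fiber a b) hab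
  have ra : rng e = rng (⟨1, a⟩ : Twist hc) := by rw [Twist.rng_eq, Twist.rng_eq, a.2.2]
  have sa : rng e = src (⟨1, a⟩ : Twist hc) := by
    rw [Twist.rng_eq, Twist.src_eq, src_of_mem_fiber a.2]
  have rb : rng e = rng (⟨1, b⟩ : Twist hc) := by rw [Twist.rng_eq, Twist.rng_eq, b.2.2]
  have sb : rng e = src (⟨1, b⟩ : Twist hc) := by
    rw [Twist.rng_eq, Twist.src_eq, src_of_mem_fiber b.2]
  have h4 := conj_mul ra sa rb sb
  rw [h1, h2, ← hχ.twistEval_mul _ _ (S.mul_mem_fiber ⟨_, S.conj_mem_fiber h a⟩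
    ⟨_, S.conj_mem_fiber h b⟩), ← twistEval_congr χ h4 hab, h3, twistEval, Twist.phase_mul,
    one_mul, one_mul]
  rfl

theorem tildeAlpha_mul (hc : IsCocycle c) (χ : S.fiber u → Circle) {γ η : G} (h : src γ = rng η)
    (hη : src η = u) (a : G) (ha : a ∈ S.fiber (rng (γ * η))) (ha' : a ∈ S.fiber (rng γ)) :
    S.tildeAlpha c (γ * η) ((src_mul' _ _ h).trans hη) χ ⟨a, ha⟩ =
      S.tildeAlpha c γ h (S.tildeAlpha c η hη χ) ⟨a, ha'⟩ := by
  let e : Twist hc := ⟨1, γ⟩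
  let f : Twist hc := ⟨1, η⟩
  have hef : src e = rng f := Twist.src_eq_rng_iff.2 h
  have ra : rng e = rng (⟨1, a⟩ : Twist hc) := by rw [Twist.rng_eq, Twist.rng_eq, ha'.2]
  have sa : rng e = src (⟨1, a⟩ : Twist hc) := by
    rw [Twist.rng_eq, Twist.src_eq, src_of_mem_fiber ha']
  have hm := S.conj_mem_fiber ((src_mul' _ _ h).trans hη) ⟨a, ha⟩
  have hm1 := S.conj_mem_fiber h ⟨a, ha'⟩
  have hm2 := S.conj_mem_fiber hη ⟨_, hm1⟩
  rw [tildeAlpha_eq_twistEval hc χ (e * f) (show _ = γ * η from rfl) _ ⟨a, ha⟩ hm,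
    twistEval_congr χ (conj_conj hef ra sa) hm hm2,
    twistEval_conj χ f (e⁻¹ * ⟨1, a⟩ * e) hη hm1 hm2,
    ← tildeAlpha_eq_twistEval hc _ e rfl h ⟨a, ha'⟩ hm1]

/-- An inner conjugation by an arrow of `S` acts trivially, because the circle is commutative. -/
theorem tildeAlpha_of_mem (hc : IsCocycle c) {χ : S.fiber u → Circle} (hχ : S.IsProjRep c χ)
    {b : G} (hb : b ∈ S.carrier) (h : src b = u) (a : G) (ha : a ∈ S.fiber (rng b))
    (ha' : a ∈ S.fiber u) : S.tildeAlpha c b h χ ⟨a, ha⟩ = χ ⟨a, ha'⟩ := by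
  let e : Twist hc := ⟨1, b⟩
  let f : Twist hc := ⟨1, a⟩
  have hbu : b ∈ S.fiber u := ⟨hb, (S.isotropy b hb).trans h⟩
  have hinv : b⁻¹ ∈ S.fiber u := ⟨S.inv_mem b hb, (rng_inv b).trans h⟩
  have he : src e⁻¹ = rng f := by
    rw [src_inv, Twist.rng_eq, Twist.rng_eq, ha.2]
  have hm := S.conj_mem_fiber h ⟨a, ha⟩
  have h1 := S.mul_mem_fiber ⟨_, hinv⟩ ⟨_, ha'⟩
  have key : e * (e⁻¹ * f * e) = f * e := by
    have hfe : src f = rng e := by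
      rw [Twist.src_eq, Twist.rng_eq, src_of_mem_fiber ha]
    rw [mul_assoc' _ _ _ he hfe, mul_inv_mul]
    rw [rng_mul' _ _ hfe, ← he, src_inv]
  have h2 := S.mul_mem_fiber ⟨_, ha'⟩ ⟨_, hbu⟩
  have h3 := S.mul_mem_fiber ⟨_, hbu⟩ ⟨_, hm⟩
  have h4 : twistEval χ (e * (e⁻¹ * f * e)) h3 = twistEval χ (f * e) h2 :=
    twistEval_congr χ key _ _
  rw [hχ.twistEval_mul hbu hm, hχ.twistEval_mul (e := f) (f := e) ha' hbu, mul_comm, mul_left_inj] at h4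
  rw [tildeAlpha_eq_twistEval hc χ e rfl h ⟨a, ha⟩ hm, h4]
  exact one_mul _

theorem tildeAlpha_congr (hc : IsCocycle c) {χ : S.fiber u → Circle} (hχ : S.IsProjRep c χ)
    {γ η : G} (hrel : S.setoid γ η) (hγ : src γ = u) (hη : src η = u) (a : G)
    (haγ : a ∈ S.fiber (rng γ)) (haη : a ∈ S.fiber (rng η)) :
    S.tildeAlpha c γ hγ χ ⟨a, haγ⟩ = S.tildeAlpha c η hη χ ⟨a, haη⟩ := by
  obtain ⟨b, hb, h, rfl⟩ := hrel
  have hbu : src b = u := by rw [← S.isotropy b hb, ← h, hγ]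
  rw [tildeAlpha_mul hc χ h hbu a haη haγ]
  have hm : γ⁻¹ * a * γ ∈ S.fiber (rng b) := S.conj_mem_fiber h ⟨a, haγ⟩
  have hm' : γ⁻¹ * a * γ ∈ S.fiber u := S.conj_mem_fiber hγ ⟨a, haγ⟩
  have := tildeAlpha_of_mem hc hχ hb hbu _ hm hm'
  rw [tildeAlpha, tildeAlpha, this]

/-- The element of the twisted dual given by `tildeAlpha`. -/
noncomputable def Dual.translate (hc : IsCocycle c) (γ : G) (χ : S.Dual c) (h : src γ = χ.unit) :
    S.Dual c :=
  ⟨Gpd.rngU γ, S.tildeAlpha c γ h χ.rep, isProjRep_tildeAlpha hc χ.isProjRep h⟩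

theorem Dual.translate_congr (hc : IsCocycle c) (χ : S.Dual c) {γ η : G} (hrel : S.setoid γ η)
    (hγ : src γ = χ.unit) (hη : src η = χ.unit) : χ.translate hc γ hγ = χ.translate hc η hη :=
  Dual.ext' (S.rng_eq_of_rel hrel) fun a ha ha' =>
    tildeAlpha_congr hc χ.isProjRep hrel hγ hη a ha ha'

theorem Dual.translate_mul (hc : IsCocycle c) (χ : S.Dual c) {γ η : G} (h : src γ = rng η)
    (hη : src η = χ.unit) :
    χ.translate hc (γ * η) ((src_mul' _ _ h).trans hη) = (χ.translate hc η hη).translate hc γ h :=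
  Dual.ext' (rng_mul' _ _ h) fun a ha ha' => tildeAlpha_mul hc χ.rep h hη a ha ha'

theorem Dual.translate_unit (hc : IsCocycle c) (χ : S.Dual c) :
    χ.translate hc χ.unit (src_of_mem χ.unit.2) = χ :=
  Dual.ext' (rng_of_mem χ.unit.2) fun a ha ha' =>
    tildeAlpha_of_mem hc χ.isProjRep (S.unit_mem _ χ.unit.2) (src_of_mem χ.unit.2) a ha ha'

/-- The action map, computed on a chosen representative of the coset. -/
noncomputable def quoAct (hc : IsCocycle c) (p : FibProd (S.moment c)) : S.Dual c :=
  p.1.2.translate hc (Quotient.out p.1.1) (src_eq_unit_of_q (Quotient.out_eq _) p.2)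

theorem quoAct_q (hc : IsCocycle c) (γ : G) (χ : S.Dual c) (h : src γ = χ.unit)
    (h' : src (S.q γ) = S.moment c χ) : quoAct hc ⟨(S.q γ, χ), h'⟩ = χ.translate hc γ h :=
  Dual.translate_congr hc χ (S.q_eq_iff.1 (Quotient.out_eq _)) _ _

end NormalIsoSubgpd

/-! ### Étale groupoids -/

section Etale

variable {G : Type*} [Gpd G] [TopologicalSpace G]

theorem IsTopologicalGpd.continuous_rng (hG : IsTopologicalGpd G) : Continuous (rng : G → G) :=
  hG.continuousOn_mul.comp_continuous (continuous_id.prodMk hG.continuous_inv)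
    fun x => (rng_inv x).symm

theorem IsTopologicalGpd.continuous_src (hG : IsTopologicalGpd G) : Continuous (src : G → G) :=
  hG.continuousOn_mul.comp_continuous (hG.continuous_inv.prodMk continuous_id) fun x => src_inv x

theorem IsTopologicalGpd.isClosed_unitSpace [T2Space G] (hG : IsTopologicalGpd G) :
    IsClosed (unitSpace G) := by
  have h : unitSpace G = {x | rng x = x} := by
    ext x
    exact ⟨fun hx => rng_of_mem hx, fun hx => ⟨x, hx⟩⟩
  rw [h]
  exact isClosed_eq hG.continuous_rng continuous_id

/-- Near a unit the range map is injective and idempotent, hence the identity. -/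
theorem IsEtaleGpd.isOpen_unitSpace (hG : IsEtaleGpd G) : IsOpen (unitSpace G) := by
  rw [isOpen_iff_mem_nhds]
  intro u hu
  obtain ⟨e, he, hr⟩ := hG.rng_localHomeo u
  have h1 : e.source ∈ 𝓝 u := e.open_source.mem_nhds he
  have h2 : rng ⁻¹' e.source ∈ 𝓝 u :=
    (e.open_source.preimage hG.continuous_rng).mem_nhds (by rwa [Set.mem_preimage, rng_of_mem hu])
  filter_upwards [h1, h2] with x hx hx'
  refine ⟨x, e.injOn hx' hx ?_⟩
  rw [← hr]
  exact Subtype.ext (rng_rng x)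

/-- Through every arrow of an étale groupoid passes a continuous local section `σ` of the source
map, defined on an open set `V` of units, whose image contains a neighbourhood `W` of the arrow. -/
theorem IsEtaleGpd.exists_section (hG : IsEtaleGpd G) (γ₀ : G) :
    ∃ (W : Set G) (V : Set (unitSpace G)) (σ : unitSpace G → G), IsOpen W ∧ γ₀ ∈ W ∧ IsOpen V ∧
      ContinuousOn σ V ∧ (∀ u ∈ V, src (σ u) = u) ∧ ∀ γ ∈ W, srcU γ ∈ V ∧ σ (srcU γ) = γ := by
  obtain ⟨e, he, hs⟩ := hG.src_localHomeo γ₀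
  refine ⟨e.source, e.target, e.symm, e.open_source, he, e.open_target, e.continuousOn_symm,
    fun u hu => ?_, fun γ hγ => ?_⟩
  · exact congrArg Subtype.val ((congrFun hs (e.symm u)).trans (e.right_inv hu))
  · rw [hs]
    exact ⟨e.map_source hγ, e.left_inv hγ⟩

namespace NormalIsoSubgpd

variable {S : NormalIsoSubgpd G} {c : G → G → Circle}

theorem continuous_q : Continuous S.q := continuous_quotient_mk'

/-- If `y b ∈ U` with `b ∈ S`, then `y' σ(s(y')) ∈ U` for `y'` near `y`, where `σ` is a local
section of the source map through `b`; its values near `s(y)` lie in the open set `S`. -/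
theorem isOpenMap_q (hG : IsEtaleGpd G) (hS : IsOpen S.carrier) : IsOpenMap S.q := by
  intro U hU
  change IsOpen (S.q ⁻¹' (S.q '' U))
  rw [isOpen_iff_mem_nhds]
  rintro y ⟨x, hx, hxy⟩
  obtain ⟨b, hb, hyb, rfl⟩ := S.q_eq_iff.1 hxy.symm
  obtain ⟨W, V, σ, -, hbW, hV, hσ, hsrc, hsec⟩ := hG.exists_section b
  obtain ⟨hbV, hσb⟩ := hsec b hbW
  have hyU : srcU y = srcU b := Subtype.ext (hyb.trans (S.isotropy b hb))
  have hsU : Continuous (srcU : G → unitSpace G) := hG.src_localHomeo.continuous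
  have hc1 : ContinuousOn (fun z : G => σ (srcU z)) (srcU ⁻¹' V) :=
    hσ.comp hsU.continuousOn fun z hz => hz
  have hN : IsOpen (srcU ⁻¹' V ∩ (fun z : G => σ (srcU z)) ⁻¹' S.carrier) :=
    hc1.isOpen_inter_preimage (hV.preimage hsU) hS
  set N := srcU ⁻¹' V ∩ (fun z : G => σ (srcU z)) ⁻¹' S.carrier
  have hyN : y ∈ N := ⟨by rwa [Set.mem_preimage, hyU], by
    change σ (srcU y) ∈ S.carrier
    rwa [hyU, hσb]⟩
  have hcomp : ∀ z ∈ N, src z = rng (σ (srcU z)) := fun z hz => by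
    rw [S.isotropy _ hz.2, hsrc _ hz.1]; rfl
  have hc2 : ContinuousOn (fun z : G => z * σ (srcU z)) N :=
    hG.continuousOn_mul.comp (continuousOn_id.prodMk (hc1.mono Set.inter_subset_left)) hcomp
  have hyb' : y * σ (srcU y) ∈ U := by rwa [hyU, hσb]
  filter_upwards [hN.mem_nhds hyN,
    (hc2.continuousAt (hN.mem_nhds hyN)).preimage_mem_nhds (hU.mem_nhds hyb')] with z hz hzU
  exact ⟨_, hzU, (S.q_eq_iff.2 ⟨_, hz.2, hcomp z hz, rfl⟩).symm⟩

/-! ### Continuity of the moment map and of the action -/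

open scoped CompactlySupported

theorem Dual.continuous_phi (f : C_c(S.carrier, ℂ)) : Continuous fun χ : S.Dual c => χ.phi f :=
  continuous_iInf_dom continuous_induced_dom

theorem Dual.continuous_iff {X : Type*} [TopologicalSpace X] {g : X → S.Dual c} :
    Continuous g ↔ ∀ f : C_c(S.carrier, ℂ), Continuous fun x => (g x).phi f := by
  rw [continuous_iInf_rng]
  exact forall_congr' fun f => continuous_induced_rng

/-- A function `f ∈ C_c(S, c)` supported in a small open set of units detects the units near a
given one: `φ_χ(f) ≠ 0` forces the unit of `χ` into that set. -/
theorem Dual.continuous_unit [T2Space G] [LocallyCompactSpace G] (hG : IsEtaleGpd G)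
    (hS : IsClosed S.carrier) : Continuous (Dual.unit : S.Dual c → unitSpace G) := by
  rw [continuous_induced_rng, continuous_def]
  intro U hU
  rw [isOpen_iff_mem_nhds]
  intro χ hχ
  have : LocallyCompactSpace S.carrier := hS.locallyCompactSpace
  let a₀ : S.carrier := ⟨χ.unit, S.unit_mem _ χ.unit.2⟩
  obtain ⟨f, hf1, hfc, hfU, -⟩ := exists_continuousMap_one_of_isCompact_subset_isOpen
    (isCompact_singleton (x := a₀))
    ((hU.inter hG.isOpen_unitSpace).preimage continuous_subtype_val)
    (Set.singleton_subset_iff.2 ⟨hχ, χ.unit.2⟩)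
  have hf0 : ∀ a : S.carrier, f a ≠ 0 → (a : G) ∈ U ∩ unitSpace G := fun a ha =>
    hfU (subset_tsupport _ ha)
  let F : C_c(S.carrier, ℂ) :=
    ⟨⟨fun a => (f a : ℂ), Complex.continuous_ofReal.comp f.continuous⟩,
      HasCompactSupport.comp_left (g := Complex.ofReal) hfc Complex.ofReal_zero⟩
  have hF : ∀ a, F a = (f a : ℂ) := fun a => rfl
  have hne : χ.phi F ≠ 0 := by
    have hmem : (χ.unit : G) ∈ S.fiber (χ.unit : G) := ⟨a₀.2, rng_of_mem χ.unit.2⟩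
    have h1 : f a₀ = 1 := hf1 rfl
    rw [Dual.phi, finsum_eq_single _ ⟨_, hmem⟩]
    · change (χ.rep ⟨_, hmem⟩ : ℂ) * (f a₀ : ℂ) ≠ 0
      rw [h1, Complex.ofReal_one, mul_one]
      exact Circle.coe_ne_zero _
    · intro a ha
      rw [hF]
      by_contra hne
      have h2 := hf0 ⟨a, a.2.1⟩ fun h0 => hne (by rw [h0, Complex.ofReal_zero, mul_zero])
      exact ha (Subtype.ext ((rng_of_mem h2.2).symm.trans a.2.2))
  filter_upwards [(Dual.continuous_phi F).isOpen_preimage _ isOpen_ne |>.mem_nhds hne] with ψ hψ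
  obtain ⟨a, ha⟩ : ∃ a : S.fiber (ψ.unit : G), (ψ.rep a : ℂ) * F ⟨a, a.2.1⟩ ≠ 0 := by
    by_contra! h0
    exact hψ ((finsum_congr h0).trans finsum_zero)
  rw [hF] at ha
  have h2 := hf0 ⟨a, a.2.1⟩ fun h0 => ha (by rw [h0, Complex.ofReal_zero, mul_zero])
  have h3 : (ψ.unit : G) = a := a.2.2.symm.trans (rng_of_mem h2.2)
  rw [Set.mem_preimage, Function.comp_apply, h3]
  exact h2.1

theorem continuous_moment [T2Space G] [LocallyCompactSpace G] (hG : IsEtaleGpd G)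
    (hS : IsClosed S.carrier) : Continuous (S.moment c) :=
  Continuous.subtype_mk (continuous_q.comp
    (continuous_subtype_val.comp (Dual.continuous_unit hG hS))) _

/-- The scalar relating `tildeAlpha c γ χ a` to `χ(b)`, for `a = γ b γ⁻¹`. -/
noncomputable def conjPhase (c : G → G → Circle) (γ a : G) : Circle :=
  (c γ γ⁻¹)⁻¹ * c γ⁻¹ a * c (γ⁻¹ * a) γ

/-- The change of variables `a = γ b γ⁻¹` in the sum defining `φ`. -/
theorem Dual.phi_translate (hc : IsCocycle c) (γ : G) (χ : S.Dual c) (h : src γ = χ.unit)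
    (f g : C_c(S.carrier, ℂ))
    (hfg : ∀ (a : S.fiber (rng γ)) (b : S.fiber (χ.unit : G)), (b : G) = γ⁻¹ * a * γ →
      g ⟨b, b.2.1⟩ = conjPhase c γ a * f ⟨a, a.2.1⟩) :
    (χ.translate hc γ h).phi f = χ.phi g := by
  refine finsum_eq_of_bijective
    (fun a : S.fiber (rng γ) => (⟨γ⁻¹ * a * γ, S.conj_mem_fiber h a⟩ : S.fiber (χ.unit : G)))
    ⟨fun a a' haa => ?_, fun b => ?_⟩ fun a => ?_
  · have h1 : γ⁻¹ * (a : G) * γ = γ⁻¹ * a' * γ := congrArg Subtype.val haa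
    exact Subtype.ext (by rw [← conj_inv_conj a.2, h1, conj_inv_conj a'.2])
  · have hb : (b : G) ∈ S.fiber (src γ) := by rw [h]; exact b.2
    exact ⟨⟨γ * b * γ⁻¹, conj_mem_fiber_rng hb⟩,
      Subtype.ext (conj_conj_inv hb.2.symm (src_of_mem_fiber hb).symm)⟩
  · have h1 : ((χ.translate hc γ h).rep a : ℂ) =
        conjPhase c γ a * χ.rep ⟨γ⁻¹ * a * γ, S.conj_mem_fiber h a⟩ := Circle.coe_mul _ _
    rw [h1, hfg a _ rfl]
    ring

/-- Locally in `γ`, the functional `f ↦ φ_{γ·χ}(f)` is `φ_χ(g)` for a single `g ∈ C_c(S, c)`: with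
`σ` a local section of the source map through `γ₀` and `h` a bump function on the unit space equal
to `1` near `s(γ₀)`, take `g(b) = h(u) k f(σ(u) b σ(u)⁻¹)`, where `u = r(b)` and `k` is the
phase of the conjugation. -/
theorem Dual.exists_phi_translate_eq [T2Space G] [LocallyCompactSpace G] (hG : IsEtaleGpd G)
    (hc : IsCocycle c) (hS : IsClopen S.carrier) (f : C_c(S.carrier, ℂ)) (γ₀ : G) :
    ∃ g : C_c(S.carrier, ℂ), ∀ᶠ (γ : G) in 𝓝 γ₀, ∀ (χ : S.Dual c) (h : src γ = χ.unit),
      (χ.translate hc γ h).phi f = χ.phi g := by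
  obtain ⟨W, V, σ, hW, hγW, hV, hσ, hsrc, hsec⟩ := hG.exists_section γ₀
  have hsU : Continuous (srcU : G → unitSpace G) := hG.src_localHomeo.continuous
  have hrU : Continuous (rngU : G → unitSpace G) := hG.rng_localHomeo.continuous
  have : LocallyCompactSpace (unitSpace G) := hG.isClosed_unitSpace.locallyCompactSpace
  obtain ⟨K, hK, hKu, hKV⟩ := exists_compact_subset hV (hsec γ₀ hγW).1
  obtain ⟨h, h1, hhc, hhV, -⟩ := exists_continuousMap_one_of_isCompact_subset_isOpen hK hV hKV
  -- `F` is the extension of `f` by zero to all of `G`.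
  let F : G → ℂ := Function.extend Subtype.val f 0
  have hFc : Continuous F := f.hasCompactSupport'.continuous_extend_zero hS.isOpen f.continuous
  have hFs : HasCompactSupport F :=
    f.hasCompactSupport'.extend_zero continuous_subtype_val
  have hFf : ∀ a : S.carrier, F a = f a := fun a =>
    Subtype.val_injective.extend_apply _ _ a
  let s : S.carrier → G := fun b => σ (rngU (b : G))
  let t : S.carrier → G := fun b => s b * b * (s b)⁻¹
  let D : Set S.carrier := (fun b : S.carrier => rngU (b : G)) ⁻¹' V
  let g : S.carrier → ℂ := fun b => h (rngU (b : G)) * (conjPhase c (s b) (t b) * F (t b))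
  have hrS : Continuous fun b : S.carrier => rngU (b : G) := hrU.comp continuous_subtype_val
  have hD : IsOpen D := hV.preimage hrS
  have hsD : ∀ b ∈ D, src (s b) = rng (b : G) := fun b hb => hsrc _ hb
  have hbD : ∀ b ∈ D, (b : G) ∈ S.fiber (src (s b)) := fun b hb => ⟨b.2, (hsD b hb).symm⟩
  have hsb : ∀ b ∈ D, src (s b * (b : G)) = src (s b) := fun b hb => by
    rw [src_mul' _ _ (hsD b hb), ← S.isotropy _ b.2, hsD b hb]
  have htD : ∀ b ∈ D, t b ∈ S.fiber (rng (s b)) := fun b hb => conj_mem_fiber_rng (hbD b hb)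
  have hst : ∀ b ∈ D, src (s b)⁻¹ = rng (t b) := fun b hb => by rw [src_inv, (htD b hb).2]
  have hts : ∀ b ∈ D, src ((s b)⁻¹ * t b) = rng (s b) := fun b hb => by
    rw [src_mul' _ _ (hst b hb), src_of_mem_fiber (htD b hb)]
  -- Continuity of `g` on the open set `D` containing its support.
  have cs : ContinuousOn s D := hσ.comp hrS.continuousOn fun b hb => hb
  have cs' : ContinuousOn (fun b => (s b)⁻¹) D := hG.continuous_inv.comp_continuousOn cs
  have ct : ContinuousOn t D :=
    hG.continuousOn_mul.comp ((hG.continuousOn_mul.comp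
      (cs.prodMk continuous_subtype_val.continuousOn) hsD).prodMk cs')
      fun b hb => (hsb b hb).trans (rng_inv _).symm
  have cst : ContinuousOn (fun b => (s b)⁻¹ * t b) D :=
    hG.continuousOn_mul.comp (cs'.prodMk ct) hst
  have ck : ContinuousOn (fun b => conjPhase c (s b) (t b)) D :=
    ((hc.continuousOn.comp (cs.prodMk cs') fun b _ => (rng_inv (s b)).symm).inv.mul
      (hc.continuousOn.comp (cs'.prodMk ct) hst)).mul
      (hc.continuousOn.comp (cst.prodMk cs) hts)
  have cg : ContinuousOn g D :=
    (Complex.continuous_ofReal.comp (h.continuous.comp hrS)).continuousOn.mul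
      ((continuous_subtype_val.comp_continuousOn ck).mul (hFc.comp_continuousOn ct))
  have hgsupp : tsupport g ⊆ D := by
    have hsub : Function.support g ⊆ (fun b : S.carrier => rngU (b : G)) ⁻¹' tsupport h := by
      intro b hb
      refine subset_tsupport _ fun h0 => hb ?_
      change (h (rngU (b : G)) : ℂ) * _ = 0
      rw [h0, Complex.ofReal_zero, zero_mul]
    exact (closure_minimal hsub ((isClosed_tsupport h).preimage hrS)).trans fun b hb => hhV hb
  have hgc : Continuous g := continuous_of_tsupport fun b hb =>
    cg.continuousAt (hD.mem_nhds (hgsupp hb))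
  -- The support of `g` lies in the image of a compact set under `(u, a) ↦ σ(u)⁻¹ a σ(u)`.
  let P : Set (unitSpace G × G) := tsupport h ×ˢ tsupport F
  have hP : IsCompact P := IsCompact.prod hhc hFs
  have cσ : ContinuousOn (fun p : unitSpace G × G => σ p.1) P :=
    hσ.comp continuousOn_fst fun p hp => hhV hp.1
  let E : unitSpace G × G → (G × G) × (G × G) :=
    fun p => ((rng (σ p.1), rng (σ p.1)), (rng p.2, src p.2))
  have cE : ContinuousOn E P := by
    have c1 := hG.continuous_rng.comp_continuousOn cσ
    exact (c1.prodMk c1).prodMk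
      ((hG.continuous_rng.comp continuous_snd).prodMk
        (hG.continuous_src.comp continuous_snd)).continuousOn
  have hC : IsCompact (P ∩ E ⁻¹' Set.diagonal (G × G)) :=
    hP.of_isClosed_subset (cE.preimage_isClosed_of_isClosed hP.isClosed isClosed_diagonal)
      Set.inter_subset_left
  have hCE : ∀ p ∈ P ∩ E ⁻¹' Set.diagonal (G × G),
      src (σ p.1)⁻¹ = rng p.2 ∧ src p.2 = rng (σ p.1) := fun p hp => by
    have hE := Prod.ext_iff.1 hp.2
    exact ⟨(src_inv _).trans hE.1, hE.2.symm⟩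
  have cj : ContinuousOn (fun p : unitSpace G × G => (σ p.1)⁻¹ * p.2 * σ p.1)
      (P ∩ E ⁻¹' Set.diagonal (G × G)) := by
    have cσ' := cσ.mono (Set.inter_subset_left (t := E ⁻¹' Set.diagonal (G × G)))
    exact hG.continuousOn_mul.comp ((hG.continuousOn_mul.comp
      ((hG.continuous_inv.comp_continuousOn cσ').prodMk continuousOn_snd)
      fun p hp => (hCE p hp).1).prodMk cσ')
      fun p hp => (src_mul' _ _ (hCE p hp).1).trans (hCE p hp).2
  have hgs : HasCompactSupport g := by
    refine HasCompactSupport.intro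
      (hS.isClosed.isClosedEmbedding_subtypeVal.isCompact_preimage (hC.image_of_continuousOn cj))
      fun b hb => ?_
    by_contra hne
    obtain ⟨hh0, hne'⟩ := mul_ne_zero_iff.1 hne
    have hF0 : F (t b) ≠ 0 := right_ne_zero_of_mul hne'
    have hhb : rngU (b : G) ∈ tsupport h :=
      subset_tsupport _ fun h0 => hh0 (by rw [h0, Complex.ofReal_zero])
    have hb' : b ∈ D := hhV hhb
    refine hb ⟨(rngU (b : G), t b), ⟨⟨hhb, subset_tsupport _ hF0⟩, ?_⟩,
      conj_conj_inv (hsD b hb') (src_of_mem_fiber (hbD b hb')).symm⟩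
    exact Prod.ext (htD b hb').2.symm (src_of_mem_fiber (htD b hb')).symm
  refine ⟨⟨⟨g, hgc⟩, hgs⟩, ?_⟩
  filter_upwards [hW.mem_nhds hγW, hsU.continuousAt.preimage_mem_nhds
    (mem_interior_iff_mem_nhds.1 hKu)] with γ hγ hγK χ hχ
  refine Dual.phi_translate hc γ χ hχ f _ fun a b hab => ?_
  have hbγ : rngU (b : G) = srcU γ := Subtype.ext (b.2.2.trans hχ.symm)
  have hsγ : s ⟨b, b.2.1⟩ = γ := by
    change σ (rngU (b : G)) = γ
    rw [hbγ, (hsec γ hγ).2]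
  have hta : t ⟨b, b.2.1⟩ = a := by
    change s ⟨b, b.2.1⟩ * (b : G) * (s ⟨b, b.2.1⟩)⁻¹ = a
    rw [hsγ, hab, conj_inv_conj a.2]
  have hh : h (rngU (b : G)) = 1 := by rw [hbγ]; exact h1 hγK
  change (h (rngU (b : G)) : ℂ) * (conjPhase c (s ⟨b, b.2.1⟩) (t ⟨b, b.2.1⟩) *
    F (t ⟨b, b.2.1⟩)) = _
  rw [hh, hsγ, hta, Complex.ofReal_one, one_mul, ← hFf]

theorem continuous_quoAct [T2Space G] [LocallyCompactSpace G] (hG : IsEtaleGpd G)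
    (hc : IsCocycle c) (hS : IsClopen S.carrier) :
    Continuous (quoAct hc : FibProd (S.moment c) → S.Dual c) := by
  -- It suffices to prove continuity on `G ∗ Ŝ_c`, since its quotient map onto `Q ∗ Ŝ_c` is open.
  have hq : IsOpenQuotientMap S.q :=
    ⟨Quotient.mk_surjective, continuous_q, isOpenMap_q hG hS.isOpen⟩
  have hqX := (hq.prodMap (IsOpenQuotientMap.id (X := S.Dual c))).restrictPreimage
    {p : S.Quo × S.Dual c | src p.1 = S.moment c p.2}
  refine hqX.isQuotientMap.continuous_iff.2 (Dual.continuous_iff.2 fun f => ?_)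
  rw [continuous_iff_continuousAt]
  intro p₀
  obtain ⟨g, hg⟩ := Dual.exists_phi_translate_eq hG hc hS f p₀.1.1
  have h1 := ((continuous_fst.comp continuous_subtype_val).tendsto p₀).eventually hg
  refine ContinuousAt.congr (f := fun p => p.1.2.phi g)
    ((Dual.continuous_phi g).comp (continuous_snd.comp continuous_subtype_val)).continuousAt ?_
  filter_upwards [h1] with p hp
  have hsrc : src p.1.1 = p.1.2.unit := src_eq_unit_of_q rfl p.2
  exact (hp p.1.2 hsrc).symm.trans
    (congrArg (fun ψ => ψ.phi f) (quoAct_q hc p.1.1 p.1.2 hsrc p.2).symm)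

end NormalIsoSubgpd

end Etale

theorem proposition4p2 {G : Type*} [Gpd G] [TopologicalSpace G] [SecondCountableTopology G]
    [LocallyCompactSpace G] [T2Space G] (hG : IsEtaleGpd G)
    (c : G → G → Circle) (hc : IsCocycle c)
    (S : NormalIsoSubgpd G) (hS : IsClopen S.carrier)
    (hcomm : ∀ a b : G, a ∈ S.carrier → b ∈ S.carrier → src a = rng b → a * b = b * a)
    (hsymm : ∀ a b : G, a ∈ S.carrier → b ∈ S.carrier → src a = rng b → c a b = c b a) :
    -- the formula depends only on the class of `γ`
    (∀ (γ η : G), S.q γ = S.q η → rng γ = rng η ∧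
      ∀ (χ : S.Dual c) (hγ : src γ = χ.unit) (hη : src η = χ.unit) (a : G)
        (haγ : a ∈ S.fiber (rng γ)) (haη : a ∈ S.fiber (rng η)),
        S.tildeAlpha c γ hγ χ.rep ⟨a, haγ⟩ = S.tildeAlpha c η hη χ.rep ⟨a, haη⟩) ∧
    -- it defines an element of `Ŝ_c` over `r(γ)`, and a continuous left action of `G / S`
    ∃ α : FibProd (S.moment c) → S.Dual c,
      (∀ (γ : G) (χ : S.Dual c) (h : src γ = χ.unit),
        ∃ hp : S.IsProjRep c (S.tildeAlpha c γ h χ.rep),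
          α ⟨(S.q γ, χ), S.src_q_eq_moment h⟩ =
            ⟨Gpd.rngU γ, S.tildeAlpha c γ h χ.rep, hp⟩) ∧
      IsContinuousLeftAction (S.moment c) α := by
  refine ⟨fun γ η h => ⟨S.rng_eq_of_rel (S.q_eq_iff.1 h), fun χ hγ hη a haγ haη =>
    NormalIsoSubgpd.tildeAlpha_congr hc χ.isProjRep (S.q_eq_iff.1 h) hγ hη a haγ haη⟩,
    NormalIsoSubgpd.quoAct hc, fun γ χ h => ⟨NormalIsoSubgpd.isProjRep_tildeAlpha hc χ.isProjRep h,
      NormalIsoSubgpd.quoAct_q hc γ χ h _⟩, ?_⟩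
  refine ⟨NormalIsoSubgpd.continuous_moment hG hS.isClosed, ?_, ?_, fun χ => ?_,
    NormalIsoSubgpd.continuous_quoAct hG hc hS⟩
  · rintro ⟨⟨⟨γ⟩, χ⟩, hp⟩
    have h := NormalIsoSubgpd.src_eq_unit_of_q (γ := γ) rfl hp
    exact (congrArg (fun ψ => (S.moment c ψ : S.Quo))
      (NormalIsoSubgpd.quoAct_q hc γ χ h hp)).trans (S.rng_q γ).symm
  · rintro ⟨γ⟩ ⟨η⟩ χ hγη hχ
    have h : src γ = rng η := (S.comp_q_iff γ η).1 hγη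
    have hη := NormalIsoSubgpd.src_eq_unit_of_q (γ := η) rfl hχ
    have h1 := NormalIsoSubgpd.quoAct_q hc η χ hη hχ
    have h2 : ∀ ψ (hψ : src (S.q γ) = S.moment c ψ), ψ = χ.translate hc η hη →
        NormalIsoSubgpd.quoAct hc ⟨(S.q γ, ψ), hψ⟩ = (χ.translate hc η hη).translate hc γ h := by
      rintro ψ hψ rfl
      exact NormalIsoSubgpd.quoAct_q hc γ _ h hψ
    refine Eq.trans ?_ (h2 _ _ h1).symm
    rw [← χ.translate_mul hc h hη, ← NormalIsoSubgpd.quoAct_q hc (γ * η) χ _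
      (S.src_q_eq_moment ((src_mul' _ _ h).trans hη))]
    congr 3
    exact S.q_mul h
  · exact (NormalIsoSubgpd.quoAct_q hc χ.unit χ (src_of_mem χ.unit.2) _).trans
      (χ.translate_unit hc)
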